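/- Work in the ring $\mathbb{Z}[q,q^{-1}]$ of Laurent polynomials in $q$ with integer coefficients. For non-negative integers $m,k$ write $[m]=1+q+\cdots+q^{m-1}$ and ${m\brack k}=\prod_{i=1}^{k}\frac{1-q^{m-i+1}}{1-q^{i}}$. Let $a,b,c,n$ be positive integers and let $j,r$ be non-negative integers with $j\le a+b+c$. Let either $\varepsilon_k=q^{j(k^2+k)-(2r+1)k}$ for all $k\ge 0$, or $\varepsilon_k=(-1)^kq^{\binom k2+j(k^2+k)-2rk}$ for all $k\ge 0$. Then, in $\mathbb{Z}[q,q^{-1}]$, $$[3n+1]\sum_{k=0}^{n}\varepsilon_k[2k+1]^{2r+1}{8n+1\brack 4n-k}^a{4n+1\brack 2n-k}^b{2n+1\brack n-k}^c$$ is divisible by $[2n+1][4n+1]{8n+1\brack 3n}$. Moreover, both for $N=n$ and for $N=2n$ (the latter being the sum over all $k\ge 0$ with non-zero terms), $$\sum_{k=0}^{N}\varepsilon_k[2k+1]^{2r+1}{8n+1\brack 4n-k}^a{6n+1\brack 3n-k}^b{4n+1\brack 2n-k}^c$$ is divisible by $[4n+1]{8n+1\brack 3n}$. -/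

import Mathlib

namespace QBinomialSums

open LaurentPolynomial

/-- The `q`-integer `[n] = 1 + q + ⋯ + q^(n-1)`, as a Laurent polynomial over `ℤ`;
the variable `q` is `T 1`, and `T e` is `q ^ e` for an integer `e`. -/
noncomputable def qInt (n : ℕ) : LaurentPolynomial ℤ :=
  ∑ i ∈ Finset.range n, T (i : ℤ)

/-- The `q`-binomial coefficient, by the `q`-Pascal rule. The theorem `qBinom_mul_prod` below
is its product formula, which determines it because `ℤ[q, q⁻¹]` is a domain. -/
noncomputable def qBinom : ℕ → ℕ → LaurentPolynomial ℤ
  | _, 0 => 1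
  | 0, _ + 1 => 0
  | n + 1, k + 1 => qBinom n k + T ((k : ℤ) + 1) * qBinom n (k + 1)

/-- The product formula: `qBinom n k` is the product over `1 ≤ i ≤ k` of
`(1 - q ^ (n - i + 1)) / (1 - q ^ i)` (here `i` is shifted by one). -/
theorem qBinom_mul_prod (n k : ℕ) :
    qBinom n k * ∏ i ∈ Finset.range k, (1 - (T ((i : ℤ) + 1) : LaurentPolynomial ℤ)) =
      ∏ i ∈ Finset.range k, (1 - (T ((n : ℤ) - i) : LaurentPolynomial ℤ)) := by
  induction n generalizing k with
  | zero =>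
    cases k with
    | zero => simp [qBinom]
    | succ k => simp [qBinom, Finset.prod_range_succ']
  | succ n ih =>
    cases k with
    | zero => simp [qBinom]
    | succ k =>
      have h1 := ih k
      have h2 := ih (k + 1)
      rw [Finset.prod_range_succ, Finset.prod_range_succ] at h2
      rw [Finset.prod_range_succ, Finset.prod_range_succ' (fun i : ℕ =>
        (1 - (T (((n + 1 : ℕ) : ℤ) - i) : LaurentPolynomial ℤ)))]
      have h3 : ∀ i : ℕ, (((n + 1 : ℕ) : ℤ) - ((i + 1 : ℕ) : ℤ)) = (n : ℤ) - i := by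
        intro i; push_cast; ring
      simp only [h3]
      have h4 : (T (((n + 1 : ℕ) : ℤ) - ((0 : ℕ) : ℤ)) : LaurentPolynomial ℤ) =
          T ((k : ℤ) + 1) * T ((n : ℤ) - k) := by
        rw [← T_add]; congr 1; push_cast; ring
      rw [h4]
      simp only [qBinom]
      linear_combination (1 - (T ((k : ℤ) + 1) : LaurentPolynomial ℤ)) * h1 +
        (T ((k : ℤ) + 1) : LaurentPolynomial ℤ) * h2

/-- The weight `q ^ (j (k² + k) - (2 r + 1) k)`. -/
noncomputable def weight (j r k : ℕ) : LaurentPolynomial ℤ :=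
  T ((j : ℤ) * ((k : ℤ) ^ 2 + k) - (2 * (r : ℤ) + 1) * k)

/-- The alternating weight `(-1) ^ k q ^ (k.choose 2 + j (k² + k) - 2 r k)`. -/
noncomputable def altWeight (j r k : ℕ) : LaurentPolynomial ℤ :=
  (-1) ^ k * T (((k.choose 2 : ℕ) : ℤ) + (j : ℤ) * ((k : ℤ) ^ 2 + k) - 2 * (r : ℤ) * k)

/-- `A ≡ B mod D` for Laurent polynomials over `ℤ`: `A - B` is `D` times a Laurent polynomial. -/
def LaurentModEq (D A B : LaurentPolynomial ℤ) : Prop :=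
  D ∣ A - B

end QBinomialSums

namespace QBinomialSums

open LaurentPolynomial

/-! Each divisor is a product of distinct cyclotomic polynomials `Φ_d` with `d ≥ 2`: those with `d`
dividing `2n+1` or `4n+1`, and those for which `3n` and `5n+1` produce a carry modulo `d`
(`qInt_mul_qInt_mul_qBinom_dvd`). It therefore suffices that the sum, or its prefactor `[3n+1]`,
vanishes at every primitive `d`-th root of unity `ζ`.

At `ζ` the summands cancel in pairs. Reversing each block `sd, ..., sd+d-1` sends `k` to `k' =
(2s+1)d-1-k`. Under this reflection `ε_k [2k+1]^(2r+1)` changes sign (`evalAt_mul_qInt_reflect`),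
while by `q`-Lucas the value of `[2u+1, u-k]` is unchanged provided it is non-zero and `2(u mod d)+1
≥ d` (`evalAt_qBinom_reflect`). What remains is residue arithmetic: if all three binomials are
non-zero at `ζ`, then all three upper parameters satisfy this inequality, and `k'` stays in the
range of summation. -/

theorem one_sub_T_ne_zero {m : ℤ} (hm : m ≠ 0) : (1 - T m : LaurentPolynomial ℤ) ≠ 0 := by
  intro h
  have h1 : (T m : LaurentPolynomial ℤ) = T 0 := by rw [T_zero]; exact (sub_eq_zero.mp h).symm
  have h2 := congrArg LaurentPolynomial.degree h1
  rw [degree_T, degree_T] at h2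
  exact hm (by exact_mod_cast h2)

/-! ### `q`-Pochhammer symbols and `q`-binomial coefficients. -/

/-- The `q`-Pochhammer symbol `(q; q)_m`. -/
noncomputable def qPoch (m : ℕ) : LaurentPolynomial ℤ :=
  ∏ i ∈ Finset.range m, (1 - T ((i : ℤ) + 1))

theorem qPoch_succ (m : ℕ) : qPoch (m + 1) = qPoch m * (1 - T ((m : ℤ) + 1)) :=
  Finset.prod_range_succ _ _

theorem qPoch_ne_zero (m : ℕ) : qPoch m ≠ 0 :=
  Finset.prod_ne_zero_iff.mpr fun i _ => one_sub_T_ne_zero (by positivity)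

theorem qBinom_succ_mul (n k : ℕ) :
    qBinom n (k + 1) * (1 - T ((k : ℤ) + 1)) = qBinom n k * (1 - T ((n : ℤ) - k)) := by
  have h1 := qBinom_mul_prod n k
  have h2 := qBinom_mul_prod n (k + 1)
  rw [Finset.prod_range_succ, Finset.prod_range_succ, ← h1] at h2
  apply mul_right_cancel₀ (qPoch_ne_zero k)
  unfold qPoch
  linear_combination h2

theorem qBinom_eq_zero {n k : ℕ} (h : n < k) : qBinom n k = 0 := by
  induction n generalizing k with
  | zero => cases k with
    | zero => omega
    | succ k => rfl
  | succ n ih => cases k with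
    | zero => omega
    | succ k => rw [qBinom, ih (by omega), ih (by omega)]; simp

theorem qBinom_add_mul_qPoch (a b : ℕ) :
    qBinom (a + b) a * (qPoch a * qPoch b) = qPoch (a + b) := by
  have h : ∀ c, (∏ i ∈ Finset.range c, (1 - (T (((c + b : ℕ) : ℤ) - i) : LaurentPolynomial ℤ))) *
      qPoch b = qPoch (c + b) := by
    intro c
    induction c with
    | zero => simp
    | succ c ih =>
      rw [Finset.prod_range_succ', show c + 1 + b = c + b + 1 by ring, qPoch_succ, ← ih]
      push_cast
      simp only [add_sub_add_right_eq_sub, sub_zero]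
      ring
  rw [← mul_assoc, ← h a, ← qBinom_mul_prod]
  rfl

theorem qBinom_symm (a b : ℕ) : qBinom (a + b) a = qBinom (a + b) b := by
  apply mul_right_cancel₀ (mul_ne_zero (qPoch_ne_zero a) (qPoch_ne_zero b))
  rw [qBinom_add_mul_qPoch, mul_comm (qPoch a), add_comm a b, qBinom_add_mul_qPoch]

/-! ### Cyclotomic factorizations and divisibility. -/

/-- The cyclotomic polynomial as a Laurent polynomial. -/
noncomputable def laurentCyclotomic (d : ℕ) : LaurentPolynomial ℤ :=
  Polynomial.toLaurent (Polynomial.cyclotomic d ℤ)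

theorem laurentCyclotomic_ne_zero (d : ℕ) : laurentCyclotomic d ≠ 0 := by
  unfold laurentCyclotomic
  rw [Polynomial.toLaurent_ne_zero]
  exact Polynomial.cyclotomic_ne_zero d ℤ

theorem one_sub_T_eq_prod {m : ℕ} (hm : 0 < m) :
    (1 - T (m : ℤ) : LaurentPolynomial ℤ) = -∏ d ∈ m.divisors, laurentCyclotomic d := by
  unfold laurentCyclotomic
  rw [← map_prod, Polynomial.prod_cyclotomic_eq_X_pow_sub_one hm]
  simp

theorem qInt_mul (m : ℕ) : qInt m * (1 - T 1) = 1 - T (m : ℤ) := by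
  induction m with
  | zero => simp [qInt]
  | succ m ih =>
    have h : (T ((m + 1 : ℕ) : ℤ) : LaurentPolynomial ℤ) = T m * T 1 := by
      rw [← T_add]; push_cast; rfl
    rw [h]
    unfold qInt at ih ⊢
    rw [Finset.sum_range_succ]
    linear_combination ih

theorem qInt_eq_prod {m : ℕ} (hm : 0 < m) :
    qInt m = ∏ d ∈ m.divisors.erase 1, laurentCyclotomic d := by
  have h1 := qInt_mul m
  have h2 := one_sub_T_eq_prod (m := 1) one_pos
  rw [Nat.divisors_one, Finset.prod_singleton, Nat.cast_one] at h2
  rw [one_sub_T_eq_prod hm, ← Finset.mul_prod_erase _ _ (Nat.one_mem_divisors.mpr hm.ne'), h2] at h1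
  apply mul_right_cancel₀ (laurentCyclotomic_ne_zero 1)
  linear_combination -h1

theorem qPoch_eq_prod {m N : ℕ} (h : m ≤ N) :
    qPoch m = (-1) ^ m * ∏ d ∈ Finset.Icc 1 N, laurentCyclotomic d ^ (m / d) := by
  induction m with
  | zero => simp [qPoch]
  | succ m ih =>
    have h1 : ∏ d ∈ Finset.Icc 1 N, laurentCyclotomic d ^ ((m + 1) / d) =
        (∏ d ∈ Finset.Icc 1 N, laurentCyclotomic d ^ (m / d)) *
          ∏ d ∈ (m + 1).divisors, laurentCyclotomic d := by
      have h2 : (m + 1).divisors = (Finset.Icc 1 N).filter (· ∣ m + 1) := by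
        ext d
        simp only [Nat.mem_divisors, Finset.mem_filter, Finset.mem_Icc]
        constructor
        · rintro ⟨hd, -⟩
          exact ⟨⟨Nat.pos_of_dvd_of_pos hd (by omega),
            (Nat.le_of_dvd (by omega) hd).trans h⟩, hd⟩
        · rintro ⟨-, hd⟩
          exact ⟨hd, by omega⟩
      rw [h2, Finset.prod_filter, ← Finset.prod_mul_distrib]
      refine Finset.prod_congr rfl fun d _ => ?_
      rw [Nat.succ_div]
      split_ifs <;> simp [pow_succ]
    have h3 := one_sub_T_eq_prod (m := m + 1) (by omega)
    push_cast at h3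
    rw [qPoch_succ, ih (by omega), h1, h3]
    ring

/-- The exponent of `Φ_d` is `⌊(a+b)/d⌋ - ⌊a/d⌋ - ⌊b/d⌋`, which is `1` if the residues of `a` and
`b` carry and `0` otherwise. In particular the product is squarefree. -/
theorem qBinom_eq_prod (a b : ℕ) :
    qBinom (a + b) a = ∏ d ∈ (Finset.Icc 1 (a + b)).filter (fun d => d ≤ a % d + b % d),
      laurentCyclotomic d := by
  apply mul_right_cancel₀ (mul_ne_zero (qPoch_ne_zero a) (qPoch_ne_zero b))
  rw [qBinom_add_mul_qPoch, qPoch_eq_prod (le_refl (a + b)), qPoch_eq_prod (Nat.le_add_right a b),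
    qPoch_eq_prod (Nat.le_add_left b a), Finset.prod_filter]
  have h : ∏ d ∈ Finset.Icc 1 (a + b), laurentCyclotomic d ^ ((a + b) / d) =
      (∏ d ∈ Finset.Icc 1 (a + b), if d ≤ a % d + b % d then laurentCyclotomic d else 1) *
      ((∏ d ∈ Finset.Icc 1 (a + b), laurentCyclotomic d ^ (a / d)) *
        ∏ d ∈ Finset.Icc 1 (a + b), laurentCyclotomic d ^ (b / d)) := by
    rw [← Finset.prod_mul_distrib, ← Finset.prod_mul_distrib]
    refine Finset.prod_congr rfl fun d hd => ?_
    rw [Nat.add_div (Finset.mem_Icc.mp hd).1]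
    split_ifs <;> ring
  rw [h]
  ring

theorem prod_laurentCyclotomic_dvd {s : Finset ℕ} (hs : ∀ d ∈ s, 0 < d)
    {A : LaurentPolynomial ℤ}
    (h : ∀ d ∈ s, ∀ ζ : ℂˣ, IsPrimitiveRoot (ζ : ℂ) d →
      LaurentPolynomial.eval₂ (Int.castRingHom ℂ) ζ A = 0) :
    ∏ d ∈ s, laurentCyclotomic d ∣ A := by
  obtain ⟨N, P, hP⟩ := A.exists_T_pow
  have h1 : ∀ d ∈ s, Polynomial.cyclotomic d ℤ ∣ P := by
    intro d hd
    have hζ := Complex.isPrimitiveRoot_exp d (hs d hd).ne'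
    rw [Polynomial.cyclotomic_eq_minpoly hζ (hs d hd)]
    apply minpoly.isIntegrallyClosed_dvd (hζ.isIntegral (hs d hd))
    have hu : (Units.mk0 _ (hζ.ne_zero (hs d hd).ne') : ℂ) = Complex.exp (2 * Real.pi * Complex.I / d) := rfl
    have h2 := h d hd (Units.mk0 _ (hζ.ne_zero (hs d hd).ne')) (by rw [hu]; exact hζ)
    have h3 := congrArg (LaurentPolynomial.eval₂ (Int.castRingHom ℂ)
      (Units.mk0 _ (hζ.ne_zero (hs d hd).ne'))) hP
    rw [map_mul, h2, zero_mul, eval₂_toLaurent] at h3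
    exact h3
  have h2 : ∏ d ∈ s, Polynomial.cyclotomic d ℤ ∣ P := by
    -- Distinct cyclotomic polynomials need not be coprime over `ℤ`, so divisibility is proved over
    -- `ℚ` and descends because the product is monic.
    have hm : (∏ d ∈ s, Polynomial.cyclotomic d ℤ).Monic :=
      Polynomial.monic_prod_of_monic _ _ fun d _ => Polynomial.cyclotomic.monic d ℤ
    rw [← Polynomial.map_dvd_map (Int.castRingHom ℚ) Int.cast_injective hm, Polynomial.map_prod]
    apply Finset.prod_dvd_of_coprime
    · intro d _ e _ hde
      simp only [Function.onFun, Polynomial.map_cyclotomic]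
      exact Polynomial.cyclotomic.isCoprime_rat hde
    · intro d hd
      exact Polynomial.map_dvd _ (h1 d hd)
  have h3 := map_dvd Polynomial.toLaurent h2
  rw [hP, map_prod] at h3
  exact (isUnit_T (N : ℤ)).dvd_mul_right.mp h3

/-! ### Evaluation at roots of unity and the `q`-Lucas theorem. -/

/-- Evaluation of a Laurent polynomial at a non-zero complex number. -/
noncomputable def evalAt (ζ : ℂˣ) : LaurentPolynomial ℤ →+* ℂ :=
  LaurentPolynomial.eval₂ (Int.castRingHom ℂ) ζ

theorem evalAt_T (ζ : ℂˣ) (m : ℤ) : evalAt ζ (T m) = (ζ : ℂ) ^ m := by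
  simp [evalAt]

theorem evalAt_T_congr {d : ℕ} {ζ : ℂˣ} (hζ : IsPrimitiveRoot (ζ : ℂ) d) {m l : ℤ}
    (h : (d : ℤ) ∣ m - l) : evalAt ζ (T m) = evalAt ζ (T l) := by
  have h1 := (hζ.zpow_eq_one_iff_dvd (m - l)).mpr h
  rw [evalAt_T, evalAt_T, show m = (m - l) + l by ring, zpow_add₀ ζ.ne_zero, h1, one_mul]

theorem evalAt_one_sub_T_ne_zero {d : ℕ} {ζ : ℂˣ} (hζ : IsPrimitiveRoot (ζ : ℂ) d) {m : ℤ}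
    (h : ¬ (d : ℤ) ∣ m) : evalAt ζ (1 - T m) ≠ 0 := by
  rw [map_sub, map_one, evalAt_T]
  intro h1
  exact h ((hζ.zpow_eq_one_iff_dvd m).mp (sub_eq_zero.mp h1).symm)

theorem evalAt_qInt_eq_zero {d : ℕ} {ζ : ℂˣ} (hζ : IsPrimitiveRoot (ζ : ℂ) d) (hd : 2 ≤ d)
    {m : ℕ} (h : d ∣ m) : evalAt ζ (qInt m) = 0 := by
  have h1 := congrArg (evalAt ζ) (qInt_mul m)
  rw [map_mul, map_sub, map_sub, evalAt_T ζ m,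
    (hζ.zpow_eq_one_iff_dvd m).mpr (by exact_mod_cast h), map_one, sub_self, ← map_one (evalAt ζ),
    ← map_sub] at h1
  refine (mul_eq_zero.mp h1).resolve_right (evalAt_one_sub_T_ne_zero hζ ?_)
  intro h2
  have := Int.le_of_dvd one_pos h2
  omega

/-- The ratio of consecutive `q`-binomials at `ζ` depends only on residues modulo `d`. The factor at
`x * d` is left unevaluated: it only matters that it depends on the lower index through its quotient
by `d`. -/
theorem evalAt_qBinom_add {d : ℕ} {ζ : ℂˣ} (hζ : IsPrimitiveRoot (ζ : ℂ) d) {M N : ℕ}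
    (hMN : (d : ℤ) ∣ (N : ℤ) - M) (x : ℕ) {e : ℕ} (he : e < d) :
    evalAt ζ (qBinom N (x * d + e)) = evalAt ζ (qBinom N (x * d)) * evalAt ζ (qBinom M e) := by
  induction e with
  | zero => simp [qBinom]
  | succ e ih =>
    have h1 := congrArg (evalAt ζ) (qBinom_succ_mul N (x * d + e))
    have h2 := congrArg (evalAt ζ) (qBinom_succ_mul M e)
    rw [map_mul, map_mul, ih (by omega)] at h1
    rw [map_mul, map_mul] at h2
    have h3 : evalAt ζ (1 - T (((x * d + e : ℕ) : ℤ) + 1)) = evalAt ζ (1 - T ((e : ℤ) + 1)) := by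
      rw [map_sub, map_sub]
      congr 1
      exact evalAt_T_congr hζ ⟨x, by push_cast; ring⟩
    have h4 : evalAt ζ (1 - T ((N : ℤ) - ((x * d + e : ℕ) : ℤ))) =
        evalAt ζ (1 - T ((M : ℤ) - e)) := by
      rw [map_sub, map_sub]
      congr 1
      obtain ⟨y, hy⟩ := hMN
      exact evalAt_T_congr hζ ⟨y - x, by push_cast; linear_combination hy⟩
    have h5 : evalAt ζ (1 - T ((e : ℤ) + 1)) ≠ 0 := by
      apply evalAt_one_sub_T_ne_zero hζ
      intro h
      have := Int.le_of_dvd (by positivity) h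
      omega
    rw [h3, h4] at h1
    apply mul_right_cancel₀ h5
    rw [← add_assoc]
    linear_combination h1 - evalAt ζ (qBinom N (x * d)) * h2

theorem evalAt_qBinom_lucas {d : ℕ} {ζ : ℂˣ} (hζ : IsPrimitiveRoot (ζ : ℂ) d) (hd : 0 < d)
    (N K : ℕ) : evalAt ζ (qBinom N K) =
      evalAt ζ (qBinom N (K / d * d)) * evalAt ζ (qBinom (N % d) (K % d)) := by
  conv_lhs => rw [← Nat.div_add_mod' K d]
  apply evalAt_qBinom_add hζ _ _ (Nat.mod_lt _ hd)
  rw [Int.natCast_mod]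
  exact Int.dvd_self_sub_emod

theorem evalAt_qBinom_eq_zero {d : ℕ} {ζ : ℂˣ} (hζ : IsPrimitiveRoot (ζ : ℂ) d) (hd : 0 < d)
    {N K : ℕ} (h : N % d < K % d) : evalAt ζ (qBinom N K) = 0 := by
  rw [evalAt_qBinom_lucas hζ hd, qBinom_eq_zero h, map_zero, mul_zero]

theorem evalAt_qBinom_congr {d : ℕ} {ζ : ℂˣ} (hζ : IsPrimitiveRoot (ζ : ℂ) d) (hd : 0 < d)
    {N K L : ℕ} (h1 : K / d = L / d) (h2 : K % d + L % d = N % d) :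
    evalAt ζ (qBinom N K) = evalAt ζ (qBinom N L) := by
  rw [evalAt_qBinom_lucas hζ hd, evalAt_qBinom_lucas hζ hd N L, h1, ← h2, qBinom_symm]

/-! ### Behaviour of the summands under reflection of a block. -/

/-- The condition on residues `e` of `u` and `t` of `k` modulo `d` for `[2u+1, u-k]` not to vanish
at primitive `d`-th roots of unity. -/
def NonvanishingResidues (d e t : ℕ) : Prop :=
  (d ≤ 2 * e + 1 ∧ d ≤ t + 1 + e ∧ t ≤ e) ∨ (2 * e + 1 < d ∧ (t ≤ e ∨ d ≤ t + 1 + e))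

theorem nonvanishingResidues_of_evalAt_ne_zero {d : ℕ} {ζ : ℂˣ}
    (hζ : IsPrimitiveRoot (ζ : ℂ) d) (hd : 0 < d) {u k : ℕ} (hk : k ≤ u)
    (h : evalAt ζ (qBinom (2 * u + 1) (u - k)) ≠ 0) :
    NonvanishingResidues d (u % d) (k % d) := by
  have h0 : (u - k) % d ≤ (2 * u + 1) % d := by
    by_contra! h1
    exact h (evalAt_qBinom_eq_zero hζ hd h1)
  have hu := Nat.div_add_mod u d
  have hk' := Nat.div_add_mod k d
  have he := Nat.mod_lt u hd
  have ht := Nat.mod_lt k hd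
  have hs : k / d ≤ u / d := Nat.div_le_div_right hk
  generalize u % d = e at *
  generalize k % d = t at *
  generalize u / d = x at *
  generalize k / d = s at *
  obtain ⟨y, rfl⟩ := Nat.exists_eq_add_of_le hs
  have hmod : ∀ m c f : ℕ, m = d * c + f → f < d → m % d = f := by
    rintro m c f rfl hf
    rw [Nat.mul_add_mod, Nat.mod_eq_of_lt hf]
  rw [mul_add] at hu
  have hN : (2 * e + 1 < d ∧ (2 * u + 1) % d = 2 * e + 1) ∨
      (d ≤ 2 * e + 1 ∧ (2 * u + 1) % d = 2 * e + 1 - d) := by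
    rcases lt_or_ge (2 * e + 1) d with h1 | h1
    · refine Or.inl ⟨h1, hmod _ (2 * (s + y)) _ ?_ h1⟩
      have : d * (2 * (s + y)) = 2 * (d * s) + 2 * (d * y) := by ring
      omega
    · refine Or.inr ⟨h1, hmod _ (2 * (s + y) + 1) _ ?_ (by omega)⟩
      have : d * (2 * (s + y) + 1) = 2 * (d * s) + 2 * (d * y) + d := by ring
      omega
  have hK : (t ≤ e ∧ (u - k) % d = e - t) ∨ (e < t ∧ (u - k) % d = e + d - t) := by
    rcases le_or_gt t e with h1 | h1
    · exact Or.inl ⟨h1, hmod _ y _ (by omega) (by omega)⟩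
    · refine Or.inr ⟨h1, ?_⟩
      cases y with
      | zero => simp at hu; omega
      | succ y =>
        refine hmod _ y _ ?_ (by omega)
        rw [mul_add] at hu
        omega
  unfold NonvanishingResidues
  omega

/-- With `e = u % d` and `t = k % d`, the lower indices have the same quotient by `d` and residues
`e-t` and `e+t+1-d`. These add up to `2e+1-d`, the residue of `2u+1`, so symmetry of the small
`q`-binomial applies. -/
theorem evalAt_qBinom_reflect {d : ℕ} {ζ : ℂˣ} (hζ : IsPrimitiveRoot (ζ : ℂ) d) (hd : 0 < d)
    {u k k' : ℕ} (hk : k ≤ u) (hk' : k' + k + 1 = (2 * (k / d) + 1) * d)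
    (h1 : d ≤ 2 * (u % d) + 1) (h2 : d ≤ k % d + 1 + u % d) (h3 : k % d ≤ u % d) :
    evalAt ζ (qBinom (2 * u + 1) (u - k')) = evalAt ζ (qBinom (2 * u + 1) (u - k)) := by
  have hu := Nat.div_add_mod u d
  have hkd := Nat.div_add_mod k d
  have he := Nat.mod_lt u hd
  have ht := Nat.mod_lt k hd
  have hs : k / d ≤ u / d := Nat.div_le_div_right hk
  generalize u % d = e at *
  generalize k % d = t at *
  generalize u / d = x at *
  generalize k / d = s at *
  obtain ⟨y, rfl⟩ := Nat.exists_eq_add_of_le hs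
  have hmod : ∀ m c f : ℕ, m = d * c + f → f < d → m % d = f ∧ m / d = c := by
    rintro m c f rfl hf
    rw [Nat.mul_add_mod, Nat.mod_eq_of_lt hf, Nat.mul_add_div hd, Nat.div_eq_of_lt hf]
    simp
  rw [mul_add] at hu
  have h4 : (2 * s + 1) * d = 2 * (d * s) + d := by ring
  have h5 : d * (2 * (s + y) + 1) = 2 * (d * s) + 2 * (d * y) + d := by ring
  obtain ⟨a1, a2⟩ := hmod (2 * u + 1) (2 * (s + y) + 1) (2 * e + 1 - d) (by omega) (by omega)
  obtain ⟨b1, b2⟩ := hmod (u - k) y (e - t) (by omega) (by omega)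
  obtain ⟨c1, c2⟩ := hmod (u - k') y (e + t + 1 - d) (by omega) (by omega)
  exact evalAt_qBinom_congr hζ hd (by omega) (by omega)

/-- Since `2k'+1 ≡ -(2k+1)` modulo `d`, this is `[-m] = -q^(-m) [m]`. -/
theorem evalAt_qInt_reflect {d : ℕ} {ζ : ℂˣ} (hζ : IsPrimitiveRoot (ζ : ℂ) d) (hd : 2 ≤ d)
    {k k' : ℕ} (h : d ∣ k + k' + 1) :
    evalAt ζ (qInt (2 * k' + 1)) =
      -((ζ : ℂ) ^ (-(2 * k + 1 : ℤ)) * evalAt ζ (qInt (2 * k + 1))) := by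
  have h0 : evalAt ζ (1 - T 1) ≠ 0 := by
    apply evalAt_one_sub_T_ne_zero hζ
    intro h2
    have := Int.le_of_dvd one_pos h2
    omega
  have h1 := congrArg (evalAt ζ) (qInt_mul (2 * k + 1))
  have h2 := congrArg (evalAt ζ) (qInt_mul (2 * k' + 1))
  rw [map_mul, map_sub _ _ (T ((_ : ℕ) : ℤ)), map_one] at h1 h2
  have h3 : evalAt ζ (T ((2 * k' + 1 : ℕ) : ℤ)) = evalAt ζ (T (-(2 * k + 1 : ℤ))) := by
    apply evalAt_T_congr hζ
    obtain ⟨y, hy⟩ := h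
    have hy' : ((k + k' + 1 : ℕ) : ℤ) = (d * y : ℕ) := by rw [hy]
    refine ⟨2 * y, ?_⟩
    push_cast at hy' ⊢
    linear_combination 2 * hy'
  rw [h3, evalAt_T] at h2
  rw [evalAt_T] at h1
  have h4 : (ζ : ℂ) ^ (-(2 * k + 1 : ℤ)) * (ζ : ℂ) ^ (((2 * k + 1 : ℕ) : ℤ)) = 1 := by
    rw [← zpow_add₀ ζ.ne_zero]
    push_cast
    simp
  apply mul_right_cancel₀ h0
  linear_combination h2 + (ζ : ℂ) ^ (-(2 * k + 1 : ℤ)) * h1 - h4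

/-- The property of a sequence of weights that makes the summands at `k` and at its reflection
`k'` inside a block of length `d` cancel at a primitive `d`-th root of unity. -/
def IsReflective (ζ : ℂˣ) (d r : ℕ) (ε : ℕ → LaurentPolynomial ℤ) : Prop :=
  ∀ k k' s : ℕ, k' + k + 1 = (2 * s + 1) * d →
    evalAt ζ (ε k') = evalAt ζ (ε k) * (ζ : ℂ) ^ ((2 * k + 1 : ℤ) * (2 * r + 1))

theorem natCast_eq_of_reflect {k k' s d : ℕ} (h : k' + k + 1 = (2 * s + 1) * d) :
    (k' : ℤ) = (2 * s + 1) * d - 1 - k := by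
  have : ((k' + k + 1 : ℕ) : ℤ) = ((2 * s + 1) * d : ℕ) := by rw [h]
  push_cast at this
  linear_combination this

theorem isReflective_weight {d : ℕ} {ζ : ℂˣ} (hζ : IsPrimitiveRoot (ζ : ℂ) d) (j r : ℕ) :
    IsReflective ζ d r (weight j r) := by
  intro k k' s h
  unfold weight
  rw [← evalAt_T, ← map_mul, ← T_add]
  apply evalAt_T_congr hζ
  rw [natCast_eq_of_reflect h]
  refine ⟨(2 * s + 1) * (j * ((2 * s + 1) * d - 1 - 2 * k) - (2 * r + 1)), ?_⟩
  ring

theorem two_mul_choose_two (k : ℕ) : (2 : ℤ) * (k.choose 2 : ℕ) = k * (k - 1) := by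
  induction k with
  | zero => simp
  | succ k ih =>
    rw [Nat.choose_succ_succ' k 1, Nat.choose_one_right]
    push_cast
    linear_combination ih

/-- For odd `d`, `k` and `k'` have equal parity. For even `d` the parities differ, and the sign is
absorbed by `ζ^(d/2) = -1`, a half period that comes from the binomial coefficient in the exponent.
-/
theorem isReflective_altWeight {d : ℕ} {ζ : ℂˣ} (hζ : IsPrimitiveRoot (ζ : ℂ) d) (hd : 2 ≤ d)
    (j r : ℕ) : IsReflective ζ d r (altWeight j r) := by
  intro k k' s h
  have hk' := natCast_eq_of_reflect h
  have hC := two_mul_choose_two k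
  have hC' := two_mul_choose_two k'
  unfold altWeight
  rw [← evalAt_T, ← map_mul, mul_assoc ((-1) ^ k), ← T_add, map_mul, map_mul, map_pow, map_pow, map_neg,
    map_one]
  rw [hk'] at hC' ⊢
  generalize ((k'.choose 2 : ℕ) : ℤ) = C' at *
  generalize ((k.choose 2 : ℕ) : ℤ) = C at *
  rcases Nat.even_or_odd' d with ⟨e, rfl | rfl⟩
  · have hsign : (-1 : ℂ) ^ k' = -(-1) ^ k := by
      have h1 : (-1 : ℂ) ^ (k' + k) = -1 := by
        apply Odd.neg_one_pow
        rw [Nat.odd_iff]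
        have : (2 * s + 1) * (2 * e) = 2 * ((2 * s + 1) * e) := by ring
        omega
      have h2 : (-1 : ℂ) ^ k * (-1) ^ k = 1 := by rw [← mul_pow]; simp
      rw [pow_add] at h1
      linear_combination (-1 : ℂ) ^ k * h1 - (-1 : ℂ) ^ k' * h2
    have hhalf : evalAt ζ (T e) = -1 := by
      have h1 : (ζ : ℂ) ^ e ^ 1 * (ζ : ℂ) ^ e = 1 := by
        rw [pow_one, ← pow_add, ← two_mul]
        exact hζ.pow_eq_one
      rw [pow_one] at h1
      rw [evalAt_T, zpow_natCast]
      refine (mul_self_eq_one_iff.mp h1).resolve_left fun h2 => ?_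
      have := Nat.le_of_dvd (by omega) (hζ.dvd_of_pow_eq_one e h2)
      omega
    have hC2 : C' = C + (2 * k + 1) + (2 * s + 1) * e * (2 * (2 * s + 1) * e - 2 * k - 3) := by
      push_cast at hC'
      have : 2 * C' = 2 * (C + (2 * k + 1) +
          (2 * s + 1) * e * (2 * (2 * s + 1) * e - 2 * k - 3)) := by
        linear_combination hC' - hC
      linarith
    rw [hsign, hC2, neg_mul, ← mul_neg]
    congr 1
    rw [neg_eq_neg_one_mul, ← hhalf, ← map_mul, ← T_add]
    apply evalAt_T_congr hζ
    refine ⟨(2 * s + 1) * (j * ((2 * s + 1) * (2 * e) - 1 - 2 * k) - 2 * r) +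
      (2 * s + 1) ^ 2 * e - k * (2 * s + 1) - 3 * s - 1, ?_⟩
    push_cast
    ring
  · have hsign : (-1 : ℂ) ^ k' = (-1) ^ k := by
      have h1 : (-1 : ℂ) ^ (k' + k) = 1 := by
        apply Even.neg_one_pow
        rw [Nat.even_iff]
        have : (2 * s + 1) * (2 * e + 1) = 2 * ((2 * s + 1) * e + s) + 1 := by ring
        omega
      have h2 : (-1 : ℂ) ^ k * (-1) ^ k = 1 := by rw [← mul_pow]; simp
      rw [pow_add] at h1
      linear_combination (-1 : ℂ) ^ k * h1 - (-1 : ℂ) ^ k' * h2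
    have hC2 : C' = C + (2 * k + 1) +
        (2 * s + 1) * (2 * e + 1) * (2 * s * e + s + e - k - 1) := by
      push_cast at hC'
      have : 2 * C' = 2 * (C + (2 * k + 1) +
          (2 * s + 1) * (2 * e + 1) * (2 * s * e + s + e - k - 1)) := by
        linear_combination hC' - hC
      linarith
    rw [hsign, hC2]
    congr 1
    apply evalAt_T_congr hζ
    refine ⟨(2 * s + 1) * (j * ((2 * s + 1) * (2 * e + 1) - 1 - 2 * k) - 2 * r) +
      (2 * s + 1) * (2 * s * e + s + e - k - 1), ?_⟩
    push_cast
    ring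

theorem evalAt_mul_qInt_reflect {d r : ℕ} {ζ : ℂˣ} (hζ : IsPrimitiveRoot (ζ : ℂ) d) (hd : 2 ≤ d)
    {ε : ℕ → LaurentPolynomial ℤ} (hε : IsReflective ζ d r ε) {k k' s : ℕ}
    (h : k' + k + 1 = (2 * s + 1) * d) :
    evalAt ζ (ε k') * evalAt ζ (qInt (2 * k' + 1)) ^ (2 * r + 1) =
      -(evalAt ζ (ε k) * evalAt ζ (qInt (2 * k + 1)) ^ (2 * r + 1)) := by
  rw [evalAt_qInt_reflect hζ hd (k := k) (k' := k')
    (by rw [add_comm k k', h]; exact Dvd.intro_left _ rfl), Odd.neg_pow ⟨r, rfl⟩, mul_pow,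
    ← zpow_natCast, ← zpow_mul, hε k k' s h]
  have h2 : (ζ : ℂ) ^ ((2 * k + 1 : ℤ) * (2 * r + 1)) *
      (ζ : ℂ) ^ (-(2 * k + 1 : ℤ) * ((2 * r + 1 : ℕ) : ℤ)) = 1 := by
    rw [← zpow_add₀ ζ.ne_zero]
    push_cast
    rw [show (2 * k + 1 : ℤ) * (2 * r + 1) + -(2 * k + 1) * (2 * r + 1) = 0 by ring, zpow_zero]
  linear_combination (-(evalAt ζ (ε k) * evalAt ζ (qInt (2 * k + 1)) ^ (2 * r + 1))) * h2

/-! ### Cancellation in pairs and the divisibility criterion. -/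

theorem sum_eq_zero_of_reflect {d N : ℕ} (hd : 0 < d) (f : ℕ → ℂ)
    (h : ∀ k ≤ N, f k ≠ 0 → ∀ k', k' + k + 1 = (2 * (k / d) + 1) * d →
      k' ≤ N ∧ f k' = -f k) : ∑ k ∈ Finset.Icc 0 N, f k = 0 := by
  rw [← Finset.sum_filter_ne_zero]
  have hex : ∀ k, ((2 * (k / d) + 1) * d - 1 - k) + k + 1 = (2 * (k / d) + 1) * d := by
    intro k
    have h1 := Nat.div_add_mod k d
    have h2 := Nat.mod_lt k hd
    have h3 : (2 * (k / d) + 1) * d = 2 * (d * (k / d)) + d := by ring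
    omega
  -- The midpoint of a block of odd length is fixed, but there `f k = -f k` forces `f k = 0`.
  refine Finset.sum_involution (fun k _ => (2 * (k / d) + 1) * d - 1 - k) ?_ ?_ ?_ ?_
  · intro k hk
    simp only [Finset.mem_filter, Finset.mem_Icc] at hk
    rw [(h k hk.1.2 hk.2 _ (hex k)).2, add_neg_cancel]
  · intro k hk h0 h1
    simp only [Finset.mem_filter, Finset.mem_Icc] at hk
    have h2 := (h k hk.1.2 hk.2 _ (hex k)).2
    rw [h1] at h2
    exact h0 (self_eq_neg.mp h2)
  · intro k hk
    simp only [Finset.mem_filter, Finset.mem_Icc] at hk ⊢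
    obtain ⟨h1, h2⟩ := h k hk.1.2 hk.2 _ (hex k)
    exact ⟨⟨by omega, h1⟩, by rw [h2]; exact neg_ne_zero.mpr hk.2⟩
  · intro k hk
    have h4 := hex k
    have h1 := Nat.div_add_mod k d
    have h2 := Nat.mod_lt k hd
    have h3 : (2 * (k / d) + 1) * d = 2 * (d * (k / d)) + d := by ring
    have h5 : ((2 * (k / d) + 1) * d - 1 - k) / d = k / d := by
      rw [Nat.div_eq_iff hd]
      have : k / d * d = d * (k / d) := mul_comm _ _
      omega
    rw [h5]
    omega

theorem evalAt_sum_eq_zero {d r a b c N u v w : ℕ} {ζ : ℂˣ} (hζ : IsPrimitiveRoot (ζ : ℂ) d)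
    (hd : 2 ≤ d) {ε : ℕ → LaurentPolynomial ℤ} (hε : IsReflective ζ d r ε)
    (ha : 0 < a) (hb : 0 < b) (hc : 0 < c) (hu : N ≤ u) (hv : N ≤ v) (hw : N ≤ w)
    (h : ∀ k ≤ N, NonvanishingResidues d (u % d) (k % d) → NonvanishingResidues d (v % d) (k % d) →
      NonvanishingResidues d (w % d) (k % d) →
      d ≤ 2 * (u % d) + 1 ∧ d ≤ 2 * (v % d) + 1 ∧ d ≤ 2 * (w % d) + 1 ∧
        d * (k / d) + (d - 1 - k % d) ≤ N) :
    evalAt ζ (∑ k ∈ Finset.Icc 0 N, ε k * qInt (2 * k + 1) ^ (2 * r + 1) *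
      qBinom (2 * u + 1) (u - k) ^ a * qBinom (2 * v + 1) (v - k) ^ b *
      qBinom (2 * w + 1) (w - k) ^ c) = 0 := by
  have hd0 : 0 < d := by omega
  rw [map_sum]
  apply sum_eq_zero_of_reflect hd0
  intro k hk h0 k' hk'
  simp only [map_mul, map_pow] at h0 ⊢
  have hU : evalAt ζ (qBinom (2 * u + 1) (u - k)) ≠ 0 := fun h1 => h0 (by simp [h1, ha.ne'])
  have hV : evalAt ζ (qBinom (2 * v + 1) (v - k)) ≠ 0 := fun h1 => h0 (by simp [h1, hb.ne'])
  have hW : evalAt ζ (qBinom (2 * w + 1) (w - k)) ≠ 0 := fun h1 => h0 (by simp [h1, hc.ne'])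
  have hU := nonvanishingResidues_of_evalAt_ne_zero hζ hd0 (hk.trans hu) hU
  have hV := nonvanishingResidues_of_evalAt_ne_zero hζ hd0 (hk.trans hv) hV
  have hW := nonvanishingResidues_of_evalAt_ne_zero hζ hd0 (hk.trans hw) hW
  obtain ⟨h1, h2, h3, h4⟩ := h k hk hU hV hW
  unfold NonvanishingResidues at hU hV hW
  have hkd := Nat.div_add_mod k d
  have hkl := Nat.mod_lt k hd0
  have h5 : (2 * (k / d) + 1) * d = 2 * (d * (k / d)) + d := by ring
  refine ⟨by omega, ?_⟩
  rw [evalAt_mul_qInt_reflect hζ hd hε hk',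
    evalAt_qBinom_reflect hζ hd0 (hk.trans hu) hk' h1 (by omega) (by omega),
    evalAt_qBinom_reflect hζ hd0 (hk.trans hv) hk' h2 (by omega) (by omega),
    evalAt_qBinom_reflect hζ hd0 (hk.trans hw) hk' h3 (by omega) (by omega)]
  ring

/-- `[m][l][a+b, a]` is a product of distinct cyclotomic polynomials when `m` and `l` are coprime
and no divisor `d ≥ 2` of either gives a carry in `a + b`. -/
theorem qInt_mul_qInt_mul_qBinom_dvd {m l a b : ℕ} (hm : 0 < m) (hl : 0 < l)
    (hml : ∀ d, 2 ≤ d → d ∣ m → ¬ d ∣ l)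
    (hcarry : ∀ d, 2 ≤ d → d ∣ m ∨ d ∣ l → a % d + b % d < d) {A : LaurentPolynomial ℤ}
    (h : ∀ d, 2 ≤ d → ∀ ζ : ℂˣ, IsPrimitiveRoot (ζ : ℂ) d →
      d ∣ m ∨ d ∣ l ∨ d ≤ a % d + b % d → evalAt ζ A = 0) :
    qInt m * qInt l * qBinom (a + b) a ∣ A := by
  have hdvd : ∀ {i : ℕ}, 0 < i → ∀ d ∈ i.divisors.erase 1, 2 ≤ d ∧ d ∣ i := by
    intro i hi d hd
    simp only [Finset.mem_erase, Nat.mem_divisors] at hd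
    have := Nat.pos_of_dvd_of_pos hd.2.1 hi
    exact ⟨by omega, hd.2.1⟩
  have hdisj : Disjoint (m.divisors.erase 1) (l.divisors.erase 1) := by
    rw [Finset.disjoint_left]
    intro d hd hd'
    exact hml d (hdvd hm d hd).1 (hdvd hm d hd).2 (hdvd hl d hd').2
  have hdisj' : Disjoint (m.divisors.erase 1 ∪ l.divisors.erase 1)
      ((Finset.Icc 1 (a + b)).filter (fun d => d ≤ a % d + b % d)) := by
    rw [Finset.disjoint_left]
    intro d hd hd'
    have h1 := (Finset.mem_filter.mp hd').2
    rcases Finset.mem_union.mp hd with h2 | h2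
    · have := hcarry d (hdvd hm d h2).1 (Or.inl (hdvd hm d h2).2)
      omega
    · have := hcarry d (hdvd hl d h2).1 (Or.inr (hdvd hl d h2).2)
      omega
  rw [qInt_eq_prod hm, qInt_eq_prod hl, qBinom_eq_prod, ← Finset.prod_union hdisj,
    ← Finset.prod_union hdisj']
  have h2 : ∀ d ∈ m.divisors.erase 1 ∪ l.divisors.erase 1 ∪
      (Finset.Icc 1 (a + b)).filter (fun d => d ≤ a % d + b % d),
      2 ≤ d ∧ (d ∣ m ∨ d ∣ l ∨ d ≤ a % d + b % d) := by
    intro d hd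
    rcases Finset.mem_union.mp hd with hd | hd
    · rcases Finset.mem_union.mp hd with hd | hd
      · exact ⟨(hdvd hm d hd).1, Or.inl (hdvd hm d hd).2⟩
      · exact ⟨(hdvd hl d hd).1, Or.inr (Or.inl (hdvd hl d hd).2)⟩
    · obtain ⟨h1, h2⟩ := Finset.mem_filter.mp hd
      have h1 := (Finset.mem_Icc.mp h1).1
      refine ⟨?_, Or.inr (Or.inr h2)⟩
      rcases eq_or_ne d 1 with rfl | h3
      · simp [Nat.mod_one] at h2
      · omega
  refine prod_laurentCyclotomic_dvd (fun d hd => by have := (h2 d hd).1; omega) ?_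
  intro d hd ζ hζ
  exact h d (h2 d hd).1 ζ hζ (h2 d hd).2

/-! ### Arithmetic of residues. -/

/-- The bound on the quotient `y` depends only on `c` and `e`. Running through its finitely many
values makes each statement about residues of multiples of `n` linear in `d` and `n % d`. -/
theorem exists_mul_mod_eq {d : ℕ} (n : ℕ) (hd : 0 < d) (c e : ℕ) :
    ∃ y < c + e + 1, (c * n + e) % d + y * d = c * (n % d) + e := by
  refine ⟨(c * (n % d) + e) / d, ?_, ?_⟩
  · rw [Nat.div_lt_iff_lt_mul hd]
    have h1 := Nat.mod_lt n hd
    nlinarith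
  · have h1 := Nat.div_add_mod' (c * (n % d) + e) d
    have h2 : (c * n + e) % d = (c * (n % d) + e) % d := by
      conv_lhs => rw [Nat.add_mod, Nat.mul_mod]
      conv_rhs => rw [Nat.add_mod, Nat.mul_mod, Nat.mod_mod]
    omega

theorem two_mul_residues_of_ratio_four_two_one {d n t : ℕ} (hd : 2 ≤ d)
    (h : d ∣ 2 * n + 1 ∨ d ∣ 4 * n + 1 ∨ d ≤ (3 * n) % d + (5 * n + 1) % d)
    (h3 : ¬ d ∣ 3 * n + 1) (ht : t < d)
    (hu : NonvanishingResidues d ((4 * n) % d) t) (hv : NonvanishingResidues d ((2 * n) % d) t)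
    (hw : NonvanishingResidues d (n % d) t) :
    d ≤ 2 * ((4 * n) % d) + 1 ∧ d ≤ 2 * ((2 * n) % d) + 1 ∧ d ≤ 2 * (n % d) + 1 := by
  have hd0 : 0 < d := by omega
  simp only [Nat.dvd_iff_mod_eq_zero] at h h3
  unfold NonvanishingResidues at *
  obtain ⟨y2, hy2, e2⟩ := exists_mul_mod_eq n hd0 2 0
  obtain ⟨y3, hy3, e3⟩ := exists_mul_mod_eq n hd0 3 0
  obtain ⟨y4, hy4, e4⟩ := exists_mul_mod_eq n hd0 4 0
  obtain ⟨y5, hy5, e5⟩ := exists_mul_mod_eq n hd0 5 1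
  obtain ⟨z2, hz2, f2⟩ := exists_mul_mod_eq n hd0 2 1
  obtain ⟨z3, hz3, f3⟩ := exists_mul_mod_eq n hd0 3 1
  obtain ⟨z4, hz4, f4⟩ := exists_mul_mod_eq n hd0 4 1
  simp only [add_zero] at e2 e3 e4
  have l1 := Nat.mod_lt n hd0
  have l2 := Nat.mod_lt (2 * n) hd0
  have l3 := Nat.mod_lt (3 * n) hd0
  have l4 := Nat.mod_lt (4 * n) hd0
  have l5 := Nat.mod_lt (5 * n + 1) hd0
  have m2 := Nat.mod_lt (2 * n + 1) hd0
  have m3 := Nat.mod_lt (3 * n + 1) hd0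
  have m4 := Nat.mod_lt (4 * n + 1) hd0
  generalize (5 * n + 1) % d = r5 at *
  generalize (2 * n + 1) % d = s2 at *
  generalize (3 * n + 1) % d = s3 at *
  generalize (4 * n + 1) % d = s4 at *
  generalize 2 * n % d = r2 at *
  generalize 3 * n % d = r3 at *
  generalize 4 * n % d = r4 at *
  generalize n % d = x at *
  interval_cases y2 <;> (try omega) <;> interval_cases y4 <;> (try omega) <;>
    interval_cases y3 <;> (try omega) <;> interval_cases y5 <;> (try omega) <;>
    interval_cases z2 <;> (try omega) <;> interval_cases z3 <;> (try omega) <;>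
    interval_cases z4 <;> omega

theorem two_mul_residues_of_ratio_four_three_two {d n t : ℕ} (hd : 2 ≤ d)
    (h : d ∣ 4 * n + 1 ∨ d ≤ (3 * n) % d + (5 * n + 1) % d) (ht : t < d)
    (hu : NonvanishingResidues d ((4 * n) % d) t) (hv : NonvanishingResidues d ((3 * n) % d) t)
    (hw : NonvanishingResidues d ((2 * n) % d) t) :
    d ≤ 2 * ((4 * n) % d) + 1 ∧ d ≤ 2 * ((3 * n) % d) + 1 ∧ d ≤ 2 * ((2 * n) % d) + 1 ∧
      -- This clause keeps reflections inside the sum truncated at `n`, where `n` is not the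
      -- parameter of any of the three binomials.
      (t ≤ n % d → d ≤ t + 1 + n % d) := by
  have hd0 : 0 < d := by omega
  simp only [Nat.dvd_iff_mod_eq_zero] at h
  unfold NonvanishingResidues at *
  obtain ⟨y2, hy2, e2⟩ := exists_mul_mod_eq n hd0 2 0
  obtain ⟨y3, hy3, e3⟩ := exists_mul_mod_eq n hd0 3 0
  obtain ⟨y4, hy4, e4⟩ := exists_mul_mod_eq n hd0 4 0
  obtain ⟨y5, hy5, e5⟩ := exists_mul_mod_eq n hd0 5 1
  obtain ⟨z4, hz4, f4⟩ := exists_mul_mod_eq n hd0 4 1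
  simp only [add_zero] at e2 e3 e4
  have l1 := Nat.mod_lt n hd0
  have l2 := Nat.mod_lt (2 * n) hd0
  have l3 := Nat.mod_lt (3 * n) hd0
  have l4 := Nat.mod_lt (4 * n) hd0
  have l5 := Nat.mod_lt (5 * n + 1) hd0
  have m4 := Nat.mod_lt (4 * n + 1) hd0
  generalize (5 * n + 1) % d = r5 at *
  generalize (4 * n + 1) % d = s4 at *
  generalize 2 * n % d = r2 at *
  generalize 3 * n % d = r3 at *
  generalize 4 * n % d = r4 at *
  generalize n % d = x at *
  interval_cases y2 <;> (try omega) <;> interval_cases y4 <;> (try omega) <;>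
    interval_cases y3 <;> (try omega) <;> interval_cases y5 <;> (try omega) <;>
    interval_cases z4 <;> omega

/-- Blocks before that of `N` lie entirely below `N`, so only the block containing `N` needs the
condition. -/
theorem reflect_le {d N k : ℕ} (hd : 0 < d) (hk : k ≤ N)
    (h : k % d ≤ N % d → d ≤ k % d + 1 + N % d) : d * (k / d) + (d - 1 - k % d) ≤ N := by
  have h1 := Nat.div_add_mod k d
  have h2 := Nat.div_add_mod N d
  have h3 := Nat.mod_lt k hd
  rcases (Nat.div_le_div_right hk : k / d ≤ N / d).lt_or_eq with h4 | h4
  · have h5 := Nat.mul_le_mul_left d (Nat.succ_le_of_lt h4)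
    rw [Nat.mul_succ] at h5
    omega
  · rw [h4] at h1 ⊢
    have := h (by omega)
    omega

theorem isReflective_of_eq_weight_or_eq_altWeight {d j r : ℕ} {ζ : ℂˣ}
    (hζ : IsPrimitiveRoot (ζ : ℂ) d) (hd : 2 ≤ d) {ε : ℕ → LaurentPolynomial ℤ}
    (hε : ε = weight j r ∨ ε = altWeight j r) : IsReflective ζ d r ε := by
  rcases hε with rfl | rfl
  · exact isReflective_weight hζ j r
  · exact isReflective_altWeight hζ hd j r

/-- If `d ∣ 4n+1`, then `3n + (5n+1) ≡ -1`, so the residues add up to `d-1`. If `d ∣ 2n+1`, both are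
congruent to `n-1` and equal `(d-3)/2`. -/
theorem carry_lt_of_dvd {d n : ℕ} (hd : 2 ≤ d) (h : d ∣ 2 * n + 1 ∨ d ∣ 4 * n + 1) :
    (3 * n) % d + (5 * n + 1) % d < d := by
  have hd0 : 0 < d := by omega
  simp only [Nat.dvd_iff_mod_eq_zero] at h
  obtain ⟨y3, hy3, e3⟩ := exists_mul_mod_eq n hd0 3 0
  obtain ⟨y5, hy5, e5⟩ := exists_mul_mod_eq n hd0 5 1
  obtain ⟨z2, hz2, f2⟩ := exists_mul_mod_eq n hd0 2 1
  obtain ⟨z4, hz4, f4⟩ := exists_mul_mod_eq n hd0 4 1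
  simp only [add_zero] at e3
  have l1 := Nat.mod_lt n hd0
  have l3 := Nat.mod_lt (3 * n) hd0
  have l5 := Nat.mod_lt (5 * n + 1) hd0
  have m2 := Nat.mod_lt (2 * n + 1) hd0
  have m4 := Nat.mod_lt (4 * n + 1) hd0
  generalize (5 * n + 1) % d = r5 at *
  generalize (2 * n + 1) % d = s2 at *
  generalize (4 * n + 1) % d = s4 at *
  generalize 3 * n % d = r3 at *
  generalize n % d = x at *
  interval_cases z2 <;> (try omega) <;> interval_cases z4 <;> (try omega) <;>
    interval_cases y3 <;> (try omega) <;> interval_cases y5 <;> omega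

end QBinomialSums

theorem corollary7p6 (a b c n j r : ℕ) (ha : 0 < a) (hb : 0 < b) (hc : 0 < c) (hn : 0 < n)
    (hj : j ≤ a + b + c) (ε : ℕ → LaurentPolynomial ℤ)
    (hε : ε = QBinomialSums.weight j r ∨ ε = QBinomialSums.altWeight j r) :
    QBinomialSums.LaurentModEq
      (QBinomialSums.qInt (2 * n + 1) * QBinomialSums.qInt (4 * n + 1) *
        QBinomialSums.qBinom (8 * n + 1) (3 * n))
      (QBinomialSums.qInt (3 * n + 1) *
        ∑ k ∈ Finset.Icc 0 n, ε k * QBinomialSums.qInt (2 * k + 1) ^ (2 * r + 1) *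
          QBinomialSums.qBinom (8 * n + 1) (4 * n - k) ^ a *
          QBinomialSums.qBinom (4 * n + 1) (2 * n - k) ^ b *
          QBinomialSums.qBinom (2 * n + 1) (n - k) ^ c)
      0 ∧
    -- the upper limits `n` and `2 * n` are both covered
    ∀ N : ℕ, N = n ∨ N = 2 * n →
      QBinomialSums.LaurentModEq
        (QBinomialSums.qInt (4 * n + 1) * QBinomialSums.qBinom (8 * n + 1) (3 * n))
        (∑ k ∈ Finset.Icc 0 N, ε k * QBinomialSums.qInt (2 * k + 1) ^ (2 * r + 1) *
          QBinomialSums.qBinom (8 * n + 1) (4 * n - k) ^ a *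
          QBinomialSums.qBinom (6 * n + 1) (3 * n - k) ^ b *
          QBinomialSums.qBinom (4 * n + 1) (2 * n - k) ^ c)
        0 := by
  open QBinomialSums in
  have h8 : 8 * n + 1 = 3 * n + (5 * n + 1) := by ring
  have h8' : 8 * n + 1 = 2 * (4 * n) + 1 := by ring
  have h6' : 6 * n + 1 = 2 * (3 * n) + 1 := by ring
  have h4' : 4 * n + 1 = 2 * (2 * n) + 1 := by ring
  refine ⟨?_, fun N hN => ?_⟩
  · unfold LaurentModEq
    rw [sub_zero]
    conv_lhs => rw [h8]
    apply qInt_mul_qInt_mul_qBinom_dvd (by omega) (by omega)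
    -- Coprimality comes from `2(2n+1) - (4n+1) = 1`.
    · intro d hd h1 h2
      have h3 := (Nat.dvd_sub (h1.mul_left 2) h2)
      rw [show 2 * (2 * n + 1) - (4 * n + 1) = 1 by omega] at h3
      have := Nat.le_of_dvd one_pos h3
      omega
    · intro d hd h
      exact carry_lt_of_dvd hd h
    · intro d hd ζ hζ h
      rw [map_mul]
      by_cases h3 : d ∣ 3 * n + 1
      · rw [evalAt_qInt_eq_zero hζ hd h3, zero_mul]
      · rw [h8', h4', evalAt_sum_eq_zero hζ hd (isReflective_of_eq_weight_or_eq_altWeight hζ hd hε)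
          ha hb hc (by omega) (by omega) le_rfl, mul_zero]
        intro k hk hu hv hw
        obtain ⟨h1, h2, h4⟩ := two_mul_residues_of_ratio_four_two_one hd h h3
          (Nat.mod_lt k (by omega)) hu hv hw
        refine ⟨h1, h2, h4, reflect_le (by omega) hk ?_⟩
        unfold NonvanishingResidues at hw
        omega
  · unfold LaurentModEq
    rw [sub_zero]
    -- A dummy factor `[1]` brings the divisor into the form of the two-factor criterion.
    have h1 : qInt 1 = 1 := by simp [qInt]
    rw [← one_mul (qInt (4 * n + 1)), ← h1]
    conv_lhs => rw [h8]
    apply qInt_mul_qInt_mul_qBinom_dvd one_pos (by omega)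
    · intro d hd h1
      have := Nat.le_of_dvd one_pos h1
      omega
    · intro d hd h
      refine carry_lt_of_dvd hd (Or.inr (h.resolve_left fun h1 => ?_))
      have := Nat.le_of_dvd one_pos h1
      omega
    · intro d hd ζ hζ h
      have h := h.resolve_left fun h1 => by
        have := Nat.le_of_dvd one_pos h1
        omega
      rw [h8', h6', h4', evalAt_sum_eq_zero hζ hd
        (isReflective_of_eq_weight_or_eq_altWeight hζ hd hε) ha hb hc (by omega) (by omega)
        (by omega)]
      intro k hk hu hv hw
      obtain ⟨h1, h2, h3, h4⟩ := two_mul_residues_of_ratio_four_three_two hd h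
        (Nat.mod_lt k (by omega)) hu hv hw
      refine ⟨h1, h2, h3, reflect_le (by omega) hk ?_⟩
      rcases hN with rfl | rfl
      · exact h4
      · unfold NonvanishingResidues at hw
        omega
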